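/- All matroids are finite. Let $M$ be a simple binary matroid of rank $r(M)=r$, viewed as a restriction of the projective geometry $G\cong \mathrm{PG}(r-1,2)$. The critical number $\chi(M)$ is the minimum nonnegative integer $k$ such that $G$ has a rank-$(r-k)$ flat disjoint from the ground set $E(M)$. The critical threshold of a simple binary matroid $N$ is the infimum of all real $\alpha>0$ for which there is an integer $k=k(N,\alpha)$ such that every simple binary matroid $M$ with no restriction isomorphic to $N$ and with $|E(M)|\ge \alpha\, 2^{r(M)}$ satisfies $\chi(M)\le k$. Theorem. Let $N$ be a simple binary matroid of rank $r(N)$ and critical number $c\ge 1$. Suppose that $\chi(N\setminus I)=c$ for every independent set $I$ of $N$ of rank $r(N)-c+1$, where $N\setminus I$ denotes the deletion of $I$ from $N$. Then the critical threshold of $N$ is exactly $1-2^{1-c}$. -/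

import Mathlib

open scoped Matroid

universe u

namespace CritMatroid

/-- The rank `r(M)` of a matroid, as a natural number (all matroids considered are finite). -/
noncomputable def rank {α : Type u} (M : Matroid α) : ℕ := M.eRank.toNat

/-- The vectors `φ e`, `e ∈ E(M)`, of `GF(2)^n` represent the matroid `M`. -/
def IsRep {α : Type u} (M : Matroid α) {n : ℕ} (φ : α → (Fin n → ZMod 2)) : Prop :=
  ∀ I ⊆ M.E, (M.Indep I ↔ LinearIndepOn (ZMod 2) φ I)

/-- `M` is a (finite) simple binary matroid. -/
structure IsSimpleBinary {α : Type u} (M : Matroid α) : Prop where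
  /-- The ground set is finite. -/
  finite : M.E.Finite
  /-- There are no loops (`e = f`) and no parallel pairs (`e ≠ f`). -/
  simple : ∀ e ∈ M.E, ∀ f ∈ M.E, M.Indep {e, f}
  /-- `M` is representable over `GF(2)`. -/
  binary : ∃ (n : ℕ) (φ : α → (Fin n → ZMod 2)), IsRep M φ

/-- The critical number `χ(M)` of a simple binary matroid `M` of rank `r`: view `M` as a restriction
of `PG(r-1,2)`, that is, represent `M` by nonzero vectors of `GF(2)^r`; a rank-`(r-c)` flat of
`PG(r-1,2)` is the set of nonzero vectors of an `(r-c)`-dimensional subspace `W` of `GF(2)^r`.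
Then `χ(M)` is the least `c` for which some such flat is disjoint from `E(M)`. -/
noncomputable def criticalNumber {α : Type u} (M : Matroid α) : ℕ :=
  sInf {c : ℕ | ∃ (r : ℕ) (φ : α → (Fin r → ZMod 2)), r = rank M ∧ IsRep M φ ∧
    ∃ W : Submodule (ZMod 2) (Fin r → ZMod 2),
      Module.finrank (ZMod 2) W + c = r ∧ ∀ e ∈ M.E, φ e ∉ W}

/-- `M` has an `N`-restriction: some restriction of `M` is isomorphic to `N`. -/
def HasRestriction {α β : Type u} (N : Matroid α) (M : Matroid β) : Prop :=
  ∃ f : N.E ↪ β, N.mapSetEmbedding f ≤r M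

/-- The set of all real `a > 0` for which there is `c` such that every simple binary matroid `M`
with no `N`-restriction and with `|M| ≥ a 2^{r(M)}` satisfies `χ(M) ≤ c`. -/
def thresholdSet {α : Type u} (N : Matroid α) : Set ℝ :=
  {a : ℝ | 0 < a ∧ ∃ c : ℕ, ∀ (β : Type u) (M : Matroid β), IsSimpleBinary M →
    ¬ HasRestriction N M → a * 2 ^ rank M ≤ (M.E.ncard : ℝ) → criticalNumber M ≤ c}

/-- The critical threshold of `N`. (The set contains every `a ≥ 1`, since a simple binary
matroid of rank `r` has fewer than `2^r` elements, and it is bounded below by `0`.) -/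
noncomputable def criticalThreshold {α : Type u} (N : Matroid α) : ℝ :=
  sInf (thresholdSet N)

end CritMatroid

/-!
Write `c` for the critical number of `N`.

*Upper bound.* A set of density more than `1 - 2 ^ (1 - c) + ε` in a large binary space contains a
Bose–Burton geometry of any given dimension, that is, the complement of a subspace `W` of
codimension `c` in some subspace `W ⊕ C` (`exists_boseBurton_of_dense`). Since `N` is itself a
restriction of such a geometry, a dense matroid with no `N`-restriction has bounded rank, hence
bounded critical number. The proof is by induction on `c`. Suppose that the complement of `W` in
`W ⊕ C` is contained in the set `E`. By a union bound over `C`, the vectors `v` with `v + C ⊆ E`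
have positive density, so some coset `x + W`, with `x` outside `W ⊕ C`, contains a dense set of
them. By `exists_submodule_many_translates` there is an affine subspace `x + a + W'` of such
vectors, where `W' ≤ W`. Then `W'` and `C + ⟨x + a⟩` continue the induction.

*Lower bound.* In a space with a subspace `T` of codimension `b = c - 1`, the complement of `T` has
density `1 - 2 ^ (1 - c)`. To it are added the points `x ⊗ ⋯ ⊗ x` (`d` factors) of
`T = (GF(2) ^ s) ^ {⊗ d}`, `x ≠ 0`. Any `d + 1` of these are independent
(`linearIndepOn_tensorPow`), and yet, for `s > k * d`, no subspace of codimension `k` avoids them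
all, by the Chevalley–Warning theorem (`exists_tensorPow_mem`). So the critical number is
unbounded. If `N` were a restriction, then its elements in `T` would be independent, and deleting
an independent set of rank `r(N) - c + 1` would reduce the critical number below `c`
(`exists_indep_criticalNumber_delete_le`), contrary to the hypothesis.

Critical numbers are computed from one representation of a matroid, which is justified by the
uniqueness of binary representations (`Represents.exists_linearMap`).
-/

namespace CritMatroid

/-! ### Dense sets in binary vector spaces -/

theorem zmod_two_eq_zero_or_one (t : ZMod 2) : t = 0 ∨ t = 1 := by
  revert t; decide

theorem card_eq_two_pow_finrank (V : Type*) [AddCommGroup V] [Module (ZMod 2) V] [Fintype V] :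
    (Fintype.card V : ℝ) = 2 ^ Module.finrank (ZMod 2) V := by
  rw [Module.card_eq_pow_finrank (K := ZMod 2)]; simp

open Classical in
theorem card_filter_mem_submodule {V : Type*} [AddCommGroup V] [Module (ZMod 2) V] [Fintype V]
    (U : Submodule (ZMod 2) V) :
    ((Finset.univ.filter fun v : V => v ∈ U).card : ℝ) = 2 ^ Module.finrank (ZMod 2) U := by
  rw [← card_eq_two_pow_finrank U, Fintype.card_subtype]

theorem finrank_sup_span_singleton {V : Type*} [AddCommGroup V] [Module (ZMod 2) V]
    [FiniteDimensional (ZMod 2) V] {W : Submodule (ZMod 2) V} {x : V} (hx : x ∉ W) :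
    Module.finrank (ZMod 2) ↥(W ⊔ Submodule.span (ZMod 2) {x}) =
      Module.finrank (ZMod 2) W + 1 := by
  have hx0 : x ≠ 0 := fun h => hx (h ▸ W.zero_mem)
  have hd := ((Submodule.disjoint_span_singleton' hx0).2 hx).eq_bot
  have := Submodule.finrank_sup_add_finrank_inf_eq W (Submodule.span (ZMod 2) {x})
  rwa [hd, finrank_bot, finrank_span_singleton hx0, add_zero] at this

/-- A dense subset of a binary space of large dimension contains a translate of a subspace of any
prescribed dimension; in fact, for a suitable subspace, it contains a positive proportion of the
translates. -/
theorem exists_submodule_many_translates {δ : ℝ} (hδ : 0 < δ) (n : ℕ) :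
    ∃ m : ℕ, ∃ η : ℝ, 0 < η ∧ ∀ (V : Type u) [AddCommGroup V] [Module (ZMod 2) V] [Fintype V],
      m ≤ Module.finrank (ZMod 2) V → ∀ S : Finset V,
      δ * Fintype.card V ≤ S.card → ∃ W : Submodule (ZMod 2) V, Module.finrank (ZMod 2) W = n ∧
        ∃ T : Finset V, η * Fintype.card V ≤ T.card ∧ ∀ a ∈ T, ∀ w ∈ W, a + w ∈ S := by
  induction n with
  | zero =>
    refine ⟨0, δ, hδ, fun V _ _ _ _ S hS => ⟨⊥, by simp, S, hS, ?_⟩⟩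
    intro a ha w hw
    rw [Submodule.mem_bot] at hw
    simpa [hw] using ha
  | succ n ih =>
    obtain ⟨m, η, hη, h⟩ := ih
    obtain ⟨m', hm'⟩ : ∃ m' : ℕ, 2 ^ (n + 1) / η < 2 ^ m' :=
      pow_unbounded_of_one_lt _ (by norm_num)
    refine ⟨max m m', η ^ 2 / 2, by positivity, fun V _ _ _ hV S hS => ?_⟩
    obtain ⟨W, hW, T, hT, hTS⟩ := h V (le_trans (le_max_left _ _) hV) S hS
    have hcard := card_eq_two_pow_finrank V
    have hVpos : (0 : ℝ) < Fintype.card V := by rw [hcard]; positivity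
    have hbig : (2 : ℝ) ^ (n + 1) ≤ η * Fintype.card V := by
      rw [div_lt_iff₀ hη] at hm'
      have : (2 : ℝ) ^ m' ≤ Fintype.card V := by
        rw [hcard]; exact pow_le_pow_right₀ (by norm_num) (le_trans (le_max_right _ _) hV)
      nlinarith
    classical
    -- The number of `a` with `a, a + h ∈ T` is averaged over all `h ∉ W`.
    let N : V → Finset V := fun h => T.filter fun a => a + h ∈ T
    have hsum : ∑ h, ((N h).card : ℝ) = (T.card : ℝ) ^ 2 := by
      have h1 : ∀ h, ((N h).card : ℝ) = ∑ a ∈ T, if a + h ∈ T then (1 : ℝ) else 0 := by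
        intro h; simp [N]
      simp_rw [h1]
      rw [Finset.sum_comm]
      have h2 : ∀ a ∈ T, (∑ h, if a + h ∈ T then (1 : ℝ) else 0) = T.card := by
        intro a _
        rw [Finset.sum_boole]
        congr 1
        exact Finset.card_bij (fun h _ => a + h) (by simp) (by simp)
          fun b hb => ⟨b - a, by simpa using hb, by simp⟩
      rw [Finset.sum_congr rfl h2]
      simp [sq]
    have hWcard : ((Finset.univ.filter fun h : V => h ∈ W).card : ℝ) = 2 ^ n := by
      rw [card_filter_mem_submodule, hW]
    obtain ⟨x, hxW, hx⟩ : ∃ x, x ∉ W ∧ η ^ 2 / 2 * Fintype.card V ≤ (N x).card := by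
      by_contra! hcon
      have h1 : ∑ h ∈ Finset.univ.filter (fun h : V => h ∈ W), ((N h).card : ℝ)
          ≤ 2 ^ n * T.card := by
        rw [← hWcard, ← nsmul_eq_mul]
        refine Finset.sum_le_card_nsmul _ _ _ fun x _ => ?_
        exact_mod_cast Finset.card_filter_le _ _
      have h2 : ∑ h ∈ Finset.univ.filter (fun h : V => ¬ h ∈ W), ((N h).card : ℝ)
          < η ^ 2 / 2 * Fintype.card V * Fintype.card V := by
        have hs : ∑ h ∈ Finset.univ.filter (fun h : V => ¬ h ∈ W), ((N h).card : ℝ)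
            ≤ ((Finset.univ.filter fun h : V => ¬ h ∈ W).card : ℝ) *
              (η ^ 2 / 2 * Fintype.card V) := by
          rw [← nsmul_eq_mul]
          refine Finset.sum_le_card_nsmul _ _ _ fun x hx => (hcon x ?_).le
          simpa using hx
        have hlt : ((Finset.univ.filter fun h : V => ¬ h ∈ W).card : ℝ) < Fintype.card V := by
          have : (Finset.univ.filter fun h : V => ¬ h ∈ W).card < (Finset.univ : Finset V).card :=
            Finset.card_lt_card (Finset.filter_ssubset.2 ⟨0, Finset.mem_univ _, by simp⟩)
          exact_mod_cast this
        refine hs.trans_lt ?_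
        rw [mul_comm]
        exact mul_lt_mul_of_pos_left hlt (by positivity)
      have h3 := Finset.sum_filter_add_sum_filter_not (Finset.univ : Finset V) (fun h => h ∈ W)
        (fun h => ((N h).card : ℝ))
      rw [hsum] at h3
      rw [pow_succ] at hbig
      nlinarith [hT, mul_pos hη hVpos]
    refine ⟨W ⊔ Submodule.span (ZMod 2) {x}, ?_, N x, hx, ?_⟩
    · rw [finrank_sup_span_singleton hxW, hW]
    · intro a ha w hw
      obtain ⟨w₀, hw₀, y, hy, rfl⟩ := Submodule.mem_sup.1 hw
      obtain ⟨t, rfl⟩ := Submodule.mem_span_singleton.1 hy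
      have ha' := Finset.mem_filter.1 ha
      rcases zmod_two_eq_zero_or_one t with rfl | rfl
      · simpa using hTS a ha'.1 w₀ hw₀
      · have := hTS _ ha'.2 w₀ hw₀
        rw [one_smul, add_comm w₀ x, ← add_assoc]
        exact this

/-- A subset of a binary space of large dimension with density bounded away from
`1 - 2 ^ (1 - c)` from above contains a copy of a Bose–Burton geometry: the complement of an
`n`-dimensional subspace `W` in a space `W ⊕ C` with `C` of dimension `c`. -/
theorem exists_boseBurton_of_dense (c : ℕ) : ∀ (n : ℕ) {ε : ℝ}, 0 < ε →
    ∃ R : ℕ, ∀ (V : Type u) [AddCommGroup V] [Module (ZMod 2) V] [Fintype V],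
      R ≤ Module.finrank (ZMod 2) V → ∀ E : Finset V,
      (1 - 2 * (1 / 2) ^ c + ε) * Fintype.card V ≤ E.card →
      ∃ W C : Submodule (ZMod 2) V, Disjoint W C ∧ Module.finrank (ZMod 2) W = n ∧
        Module.finrank (ZMod 2) C = c ∧ ∀ w ∈ W, ∀ y ∈ C, y ≠ 0 → w + y ∈ E := by
  induction c with
  | zero =>
    intro n ε hε
    refine ⟨n, fun V _ _ _ hn E _ => ?_⟩
    obtain ⟨f, hf⟩ := exists_linearIndependent_of_le_finrank hn
    exact ⟨Submodule.span (ZMod 2) (Set.range f), ⊥, disjoint_bot_right,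
      by simpa using finrank_span_eq_card hf, by simp, by simp +contextual⟩
  | succ c ih =>
    intro n ε hε
    obtain ⟨m, η, hη, hm⟩ := exists_submodule_many_translates.{u} (half_pos hε) n
    obtain ⟨R, hR⟩ := ih m hε
    obtain ⟨R', hR'⟩ : ∃ R' : ℕ, 2 ^ (m + c + 1) / ε < 2 ^ R' :=
      pow_unbounded_of_one_lt _ (by norm_num)
    refine ⟨max R R', fun V _ _ _ hV E hE => ?_⟩
    have hcard := card_eq_two_pow_finrank V
    have hVpos : (0 : ℝ) < Fintype.card V := by rw [hcard]; positivity
    have hbig : (2 : ℝ) ^ (m + c) * 2 ≤ ε * Fintype.card V := by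
      rw [div_lt_iff₀ hε, pow_succ] at hR'
      have : (2 : ℝ) ^ R' ≤ Fintype.card V := by
        rw [hcard]; exact pow_le_pow_right₀ (by norm_num) (le_trans (le_max_right _ _) hV)
      nlinarith
    obtain ⟨W, C, hWC, hW, hC, hE'⟩ := hR V (le_trans (le_max_left _ _) hV) E (by
      refine le_trans (mul_le_mul_of_nonneg_right ?_ hVpos.le) hE
      rw [pow_succ]
      have : (0 : ℝ) < (1 / 2) ^ c := by positivity
      linarith)
    classical
    -- The translates of `C` contained in `E` have density at least `ε`, by a union bound.
    let S : Finset V := Finset.univ.filter fun v => ∀ y ∈ C, v + y ∈ E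
    have hS : ε * Fintype.card V ≤ S.card := by
      have h1 : Sᶜ ⊆ (Finset.univ.filter fun h : V => h ∈ C).biUnion
          fun y => Finset.univ.filter fun v => v + y ∈ Eᶜ := by
        intro v hv
        simpa [S] using hv
      have h2 : ∀ y : V, (Finset.univ.filter fun v => v + y ∈ Eᶜ).card = Eᶜ.card := by
        intro y
        refine Finset.card_bij (fun v _ => v + y) (by simp) (by simp) fun b hb => ⟨b - y, ?_, ?_⟩
        · simpa using hb
        · simp
      have h3 : (Sᶜ.card : ℝ) ≤ 2 ^ c * Eᶜ.card := by
        have h4 := (Finset.card_le_card h1).trans Finset.card_biUnion_le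
        rw [Finset.sum_congr rfl (fun y _ => h2 y), Finset.sum_const, smul_eq_mul] at h4
        rw [← hC, ← card_filter_mem_submodule C]
        exact_mod_cast h4
      have h5 : (Sᶜ.card : ℝ) = Fintype.card V - S.card := by
        rw [Finset.card_compl, Nat.cast_sub (Finset.card_le_univ _)]
      have h6 : (Eᶜ.card : ℝ) = Fintype.card V - E.card := by
        rw [Finset.card_compl, Nat.cast_sub (Finset.card_le_univ _)]
      rw [h5, h6] at h3
      have h7 : (2 : ℝ) ^ c * (1 / 2) ^ c = 1 := by rw [← mul_pow]; norm_num
      have h8 : (1 : ℝ) ≤ 2 ^ c := one_le_pow₀ (by norm_num)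
      rw [pow_succ] at hE
      have h9 := mul_le_mul_of_nonneg_left hE (zero_le_one.trans h8)
      have h10 : (2 : ℝ) ^ c * ((1 - 2 * ((1 / 2) ^ c * (1 / 2)) + ε) * Fintype.card V)
          = 2 ^ c * Fintype.card V - Fintype.card V + 2 ^ c * (ε * Fintype.card V) := by
        linear_combination (-(Fintype.card V : ℝ)) * h7
      rw [h10] at h9
      nlinarith [mul_le_mul_of_nonneg_right h8 (mul_pos hε hVpos).le]
    have hV₀ : Module.finrank (ZMod 2) ↥(W ⊔ C) = m + c := by
      have := Submodule.finrank_sup_add_finrank_inf_eq W C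
      rwa [hWC.eq_bot, finrank_bot, add_zero, hW, hC] at this
    let P : Finset V := Finset.univ.filter fun x => x ∉ W ⊔ C
    have hSP : ε / 2 * Fintype.card V ≤ (S ∩ P).card := by
      have h1 : S ⊆ (S ∩ P) ∪ Finset.univ.filter fun h : V => h ∈ W ⊔ C := by
        intro v hv
        by_cases h : v ∈ W ⊔ C <;> simp [P, h, hv]
      have h2 : (S.card : ℝ) ≤ (S ∩ P).card + 2 ^ (m + c) := by
        rw [← hV₀, ← card_filter_mem_submodule]
        exact_mod_cast (Finset.card_le_card h1).trans (Finset.card_union_le _ _)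
      linarith
    -- Some coset `x + W` outside `W ⊔ C` is dense in `S`, by double counting.
    let Q : V → Finset W := fun x => Finset.univ.filter fun w => x + w ∈ S
    have hsum : ∑ x ∈ P, ((Q x).card : ℝ) = Fintype.card W * (S ∩ P).card := by
      have h1 : ∀ x, ((Q x).card : ℝ) = ∑ w : W, if x + w ∈ S then (1 : ℝ) else 0 := by
        intro x; simp [Q]
      simp_rw [h1]
      rw [Finset.sum_comm]
      have h2 : ∀ w : W, (∑ x ∈ P, if x + w ∈ S then (1 : ℝ) else 0) = (S ∩ P).card := by
        intro w
        rw [Finset.sum_boole]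
        congr 1
        have hwV : (w : V) ∈ W ⊔ C := Submodule.mem_sup_left w.2
        refine Finset.card_bij (fun x _ => x + w) ?_ (by simp) fun b hb => ⟨b - w, ?_, by simp⟩
        · intro x hx
          have hx' := Finset.mem_filter.1 hx
          have hxP : x ∉ W ⊔ C := by simpa [P] using hx'.1
          refine Finset.mem_inter.2 ⟨hx'.2, ?_⟩
          simpa [P] using fun h => hxP ((Submodule.add_mem_iff_left _ hwV).1 h)
        · have hb' := Finset.mem_inter.1 hb
          have hbP : b ∉ W ⊔ C := by simpa [P] using hb'.2
          refine Finset.mem_filter.2 ⟨?_, by simpa using hb'.1⟩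
          simpa [P] using fun h => hbP ((Submodule.sub_mem_iff_left _ hwV).1 h)
      simp [h2]
    obtain ⟨x, hxP, hx⟩ : ∃ x ∈ P, ε / 2 * Fintype.card W ≤ (Q x).card := by
      by_contra! hcon
      have hWpos : (0 : ℝ) < Fintype.card W := by exact_mod_cast Fintype.card_pos
      have hPne : P.Nonempty := by
        have : (0 : ℝ) < (S ∩ P).card := lt_of_lt_of_le (by positivity) hSP
        exact (Finset.card_pos.1 (by exact_mod_cast this)).mono Finset.inter_subset_right
      have h1 := Finset.sum_lt_sum_of_nonempty hPne hcon
      rw [hsum, Finset.sum_const, nsmul_eq_mul] at h1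
      have h2 : (P.card : ℝ) ≤ Fintype.card V := by exact_mod_cast Finset.card_le_univ _
      have h3 : (P.card : ℝ) * (ε / 2 * Fintype.card W) ≤
          Fintype.card V * (ε / 2 * Fintype.card W) :=
        mul_le_mul_of_nonneg_right h2 (by positivity)
      nlinarith
    obtain ⟨W', hW', T, hT, hTQ⟩ := hm W hW.ge (Q x) hx
    obtain ⟨a, ha⟩ : T.Nonempty := by
      have : (0 : ℝ) < T.card :=
        lt_of_lt_of_le (mul_pos hη (by exact_mod_cast Fintype.card_pos)) hT
      exact Finset.card_pos.1 (by exact_mod_cast this)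
    have hxa : x + a ∉ W ⊔ C := by
      have hxP' : x ∉ W ⊔ C := by simpa [P] using hxP
      exact fun h => hxP' ((Submodule.add_mem_iff_left _ (Submodule.mem_sup_left a.2)).1 h)
    have hxaC : x + a ∉ C := fun h => hxa (Submodule.mem_sup_right h)
    refine ⟨W'.map W.subtype, C ⊔ Submodule.span (ZMod 2) {x + (a : V)}, ?_, ?_, ?_, ?_⟩
    · rw [Submodule.disjoint_def]
      intro v hv hv'
      obtain ⟨w, -, rfl⟩ := Submodule.mem_map.1 hv
      obtain ⟨y, hy, z, hz, hyz⟩ := Submodule.mem_sup.1 hv'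
      obtain ⟨t, rfl⟩ := Submodule.mem_span_singleton.1 hz
      rcases zmod_two_eq_zero_or_one t with rfl | rfl
      · rw [zero_smul, add_zero] at hyz
        exact Submodule.disjoint_def.1 hWC _ w.2 (hyz ▸ hy)
      · rw [one_smul] at hyz
        refine absurd ?_ hxa
        rw [← Submodule.add_mem_iff_right _ (Submodule.mem_sup_right hy : y ∈ W ⊔ C), hyz]
        exact Submodule.mem_sup_left w.2
    · rw [Submodule.finrank_map_subtype_eq, hW']
    · rw [finrank_sup_span_singleton hxaC, hC]
    · intro w hw y hy hy0
      obtain ⟨w, hw', rfl⟩ := Submodule.mem_map.1 hw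
      obtain ⟨y, hy', z, hz, rfl⟩ := Submodule.mem_sup.1 hy
      obtain ⟨t, rfl⟩ := Submodule.mem_span_singleton.1 hz
      rcases zmod_two_eq_zero_or_one t with rfl | rfl
      · rw [zero_smul, add_zero] at hy0 ⊢
        exact hE' _ w.2 y hy' hy0
      · have h1 := (Finset.mem_filter.1 (hTQ a ha w hw')).2
        have h2 := (Finset.mem_filter.1 h1).2 y hy'
        rw [one_smul]
        convert h2 using 1
        push_cast [Submodule.subtype_apply]
        abel

/-! ### Tensor powers of binary vectors -/

/-- Over `GF(2)`, linear independence means that no nonempty finite subfamily sums to zero. -/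
theorem linearIndepOn_iff_sum_ne_zero {α V : Type*} [AddCommGroup V] [Module (ZMod 2) V]
    {φ : α → V} {s : Set α} :
    LinearIndepOn (ZMod 2) φ s ↔ ∀ t : Finset α, ↑t ⊆ s → ∑ e ∈ t, φ e = 0 → t = ∅ := by
  classical
  rw [linearIndepOn_iff']
  constructor
  · intro h t hts ht
    have := h t (fun _ => 1) hts (by simpa using ht)
    exact Finset.eq_empty_of_forall_notMem fun e he => one_ne_zero (this e he)
  · intro h t g hts ht e he
    have key : t.filter (fun e => g e = 1) = ∅ := by
      refine h _ (fun e he => hts (Finset.mem_filter.1 he).1) ?_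
      rw [← ht, Finset.sum_filter]
      refine Finset.sum_congr rfl fun e _ => ?_
      rcases zmod_two_eq_zero_or_one (g e) with h | h <;> simp [h]
    rcases zmod_two_eq_zero_or_one (g e) with h | h
    · exact h
    · exact absurd (key ▸ Finset.mem_filter.2 ⟨he, h⟩) (Finset.notMem_empty e)

/-- The `d`-th tensor power `x ⊗ ⋯ ⊗ x` of a vector `x` of `GF(2)^s`, in coordinates. -/
def tensorPow (d : ℕ) {s : ℕ} (x : Fin s → ZMod 2) : (Fin d → Fin s) → ZMod 2 :=
  fun i => ∏ j, x (i j)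

theorem sum_mul_tensorPow {d s : ℕ} (A : Fin d → Fin s → ZMod 2) (x : Fin s → ZMod 2) :
    ∑ i, (∏ j, A j (i j)) * tensorPow d x i = ∏ j, ∑ l, A j l * x l := by
  rw [Finset.prod_univ_sum]
  simp [tensorPow, Finset.prod_mul_distrib]

theorem tensorPow_zero {d s : ℕ} (hd : d ≠ 0) : tensorPow d (0 : Fin s → ZMod 2) = 0 := by
  funext i
  simp [tensorPow, hd]

theorem exists_linearForm_eq_one {s : ℕ} {x : Fin s → ZMod 2} (hx : x ≠ 0) :
    ∃ a : Fin s → ZMod 2, ∑ l, a l * x l = 1 := by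
  obtain ⟨i, hi⟩ := Function.ne_iff.1 hx
  refine ⟨Pi.single i 1, ?_⟩
  simpa [Pi.single_apply] using (zmod_two_eq_zero_or_one (x i)).resolve_left hi

/-- Over `GF(2)`, a nonzero vector `x` is not a multiple of any other vector, except for the zero
multiple, so some linear form is `1` at `x` and `0` at `y`. -/
theorem exists_linearForm_separating {s : ℕ} {x y : Fin s → ZMod 2} (hx : x ≠ 0) (hxy : x ≠ y) :
    ∃ a : Fin s → ZMod 2, ∑ l, a l * x l = 1 ∧ ∑ l, a l * y l = 0 := by
  by_cases h : ∃ i, x i = 1 ∧ y i = 0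
  · obtain ⟨i, hi, hi'⟩ := h
    exact ⟨Pi.single i 1, by simp [Pi.single_apply, hi], by simp [Pi.single_apply, hi']⟩
  · push Not at h
    obtain ⟨i, hi⟩ := Function.ne_iff.1 hx
    have hi1 := (zmod_two_eq_zero_or_one (x i)).resolve_left hi
    have hyi := (zmod_two_eq_zero_or_one (y i)).resolve_left (h i hi1)
    obtain ⟨j, hj⟩ := Function.ne_iff.1 hxy
    have hxj : x j = 0 := by
      rcases zmod_two_eq_zero_or_one (x j) with h0 | h1
      · exact h0
      · have := (zmod_two_eq_zero_or_one (y j)).resolve_left (h j h1)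
        exact absurd (h1.trans this.symm) hj
    have hyj : y j = 1 :=
      (zmod_two_eq_zero_or_one (y j)).resolve_left fun h0 => hj (hxj.trans h0.symm)
    refine ⟨Pi.single i 1 + Pi.single j 1, ?_, ?_⟩
    · simp [Pi.single_apply, add_mul, Finset.sum_add_distrib, hi1, hxj]
    · simp [Pi.single_apply, add_mul, Finset.sum_add_distrib, hyi, hyj]
      decide

/-- The `d`-th tensor powers of at most `d + 1` distinct nonzero vectors are independent: a product
of `d` linear forms separates any one of the vectors from all others. -/
theorem linearIndepOn_tensorPow {α : Type*} {d s : ℕ} {x : α → Fin s → ZMod 2} {I : Set α}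
    (hfin : I.Finite) (hcard : I.ncard ≤ d + 1) (h0 : ∀ e ∈ I, x e ≠ 0) (hinj : Set.InjOn x I) :
    LinearIndepOn (ZMod 2) (fun e => tensorPow d (x e)) I := by
  classical
  rw [linearIndepOn_iff_sum_ne_zero]
  intro t ht hsum
  by_contra hne
  obtain ⟨e₀, he₀⟩ := Finset.nonempty_iff_ne_empty.2 hne
  have hcard' : (t.erase e₀).card ≤ d := by
    have h1 : t.card ≤ I.ncard := by
      rw [← Set.ncard_coe_finset]; exact Set.ncard_le_ncard ht hfin
    have h2 := Finset.card_erase_add_one he₀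
    omega
  obtain ⟨f⟩ : Nonempty (↥(t.erase e₀) ↪ Fin d) :=
    Function.Embedding.nonempty_of_card_le (by simpa using hcard')
  have hsep : ∀ e : ↥(t.erase e₀), ∃ a : Fin s → ZMod 2,
      ∑ l, a l * x e₀ l = 1 ∧ ∑ l, a l * x e l = 0 := by
    rintro ⟨e, he⟩
    have he' := Finset.mem_erase.1 he
    exact exists_linearForm_separating (h0 _ (ht he₀))
      fun h => he'.1 (hinj (ht he'.2) (ht he₀) h.symm)
  choose a ha ha' using hsep
  obtain ⟨b, hb⟩ := exists_linearForm_eq_one (h0 _ (ht he₀))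
  let A : Fin d → Fin s → ZMod 2 := Function.extend f a fun _ => b
  have hA : ∀ j, ∑ l, A j l * x e₀ l = 1 := by
    intro j
    by_cases hj : ∃ e, f e = j
    · obtain ⟨e, rfl⟩ := hj
      simp only [A, f.injective.extend_apply, ha]
    · simp only [A, Function.extend_apply' _ _ _ hj, hb]
  have hA' : ∀ e ∈ t.erase e₀, ∏ j, ∑ l, A j l * x e l = 0 := by
    intro e he
    refine Finset.prod_eq_zero (Finset.mem_univ (f ⟨e, he⟩)) ?_
    simp only [A, f.injective.extend_apply]
    exact ha' ⟨e, he⟩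
  have h1 : ∑ e ∈ t, ∏ j, ∑ l, A j l * x e l = 1 := by
    rw [← Finset.add_sum_erase _ _ he₀, Finset.sum_eq_zero hA', add_zero]
    exact Finset.prod_eq_one fun j _ => hA j
  simp_rw [← sum_mul_tensorPow] at h1
  rw [Finset.sum_comm] at h1
  simp_rw [← Finset.mul_sum] at h1
  have h2 : ∀ i, ∑ e ∈ t, tensorPow d (x e) i = 0 := fun i => by
    simpa using congrFun hsum i
  simp [h2] at h1

/-- Subspaces of codimension at most `k` contain the tensor power of a nonzero vector, if `x` has
more than `k * d` coordinates. The subspace is cut out by at most `k` forms of degree `d`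
in `x`, so the Chevalley–Warning theorem gives a zero other than `x = 0`. -/
theorem exists_tensorPow_mem {d s k : ℕ} (hd : d ≠ 0) (hs : k * d < s)
    (W : Submodule (ZMod 2) ((Fin d → Fin s) → ZMod 2))
    (hW : Module.finrank (ZMod 2) ((Fin d → Fin s) → ZMod 2) ≤ Module.finrank (ZMod 2) W + k) :
    ∃ x : Fin s → ZMod 2, x ≠ 0 ∧ tensorPow d x ∈ W := by
  classical
  let T := (Fin d → Fin s) → ZMod 2
  let q := Module.finrank (ZMod 2) (T ⧸ W)
  have hq : q ≤ k := by
    have := W.finrank_quotient_add_finrank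
    change q + _ = Module.finrank (ZMod 2) ((Fin d → Fin s) → ZMod 2) at this
    omega
  let g : T →ₗ[ZMod 2] (Fin q → ZMod 2) :=
    (Module.finBasis (ZMod 2) (T ⧸ W)).equivFun.toLinearMap ∘ₗ W.mkQ
  have hg : ∀ v, g v = 0 → v ∈ W := by
    intro v hv
    simpa [g] using hv
  let f : Fin q → MvPolynomial (Fin s) (ZMod 2) := fun j =>
    ∑ i : Fin d → Fin s, MvPolynomial.C (g (Pi.single i 1) j) * ∏ l, MvPolynomial.X (i l)
  have hdeg : ∀ j, (f j).totalDegree ≤ d := by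
    intro j
    refine MvPolynomial.IsHomogeneous.totalDegree_le ?_
    refine MvPolynomial.IsHomogeneous.sum _ _ _ fun i _ => ?_
    have h1 := MvPolynomial.IsHomogeneous.prod Finset.univ
      (fun l => (MvPolynomial.X (i l) : MvPolynomial (Fin s) (ZMod 2))) (fun _ => 1)
      fun l _ => MvPolynomial.isHomogeneous_X _ _
    simpa using h1.C_mul (g (Pi.single i 1) j)
  have heval : ∀ j x, MvPolynomial.eval x (f j) = g (tensorPow d x) j := by
    intro j x
    conv_rhs => rw [LinearMap.pi_apply_eq_sum_univ g (tensorPow d x)]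
    simp only [f, map_sum, map_mul, MvPolynomial.eval_C, map_prod, MvPolynomial.eval_X,
      Finset.sum_apply, Pi.smul_apply, smul_eq_mul, tensorPow]
    refine Finset.sum_congr rfl fun i _ => ?_
    rw [mul_comm]
    refine congrArg (fun v => (∏ l, x (i l)) * g v j) ?_
    funext i'
    simp [Pi.single_apply, eq_comm]
  have hdvd := char_dvd_card_solutions_of_fintype_sum_lt (K := ZMod 2) 2 (f := f) (by
    calc ∑ j, (f j).totalDegree ≤ ∑ _j : Fin q, d := Finset.sum_le_sum fun j _ => hdeg j
      _ = q * d := by simp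
      _ ≤ k * d := Nat.mul_le_mul_right _ hq
      _ < _ := by simpa using hs)
  let z : { x : Fin s → ZMod 2 // ∀ j, MvPolynomial.eval x (f j) = 0 } :=
    ⟨0, fun j => by rw [heval, tensorPow_zero hd]; simp⟩
  have hdvd' : 2 ∣ Nat.card { x : Fin s → ZMod 2 // ∀ j, MvPolynomial.eval x (f j) = 0 } := by
    rw [Nat.card_eq_fintype_card]
    convert hdvd
  have : Nonempty { x : Fin s → ZMod 2 // ∀ j, MvPolynomial.eval x (f j) = 0 } := ⟨z⟩
  have : Nontrivial { x : Fin s → ZMod 2 // ∀ j, MvPolynomial.eval x (f j) = 0 } :=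
    Finite.one_lt_card_iff_nontrivial.1 (Nat.le_of_dvd Nat.card_pos hdvd')
  obtain ⟨y, hy⟩ := exists_ne z
  refine ⟨y.1, fun h => hy (Subtype.ext h), hg _ ?_⟩
  funext j
  rw [← heval]
  exact y.2 j

/-! ### Binary representations of matroids -/

/-- The vectors `φ e`, `e ∈ E(M)`, of an arbitrary vector space over `GF(2)` represent `M`;
for coordinate spaces this is `IsRep`. -/
def Represents {α V : Type*} [AddCommGroup V] [Module (ZMod 2) V] (M : Matroid α) (φ : α → V) :
    Prop :=
  ∀ I ⊆ M.E, (M.Indep I ↔ LinearIndepOn (ZMod 2) φ I)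

theorem finrank_map_of_injOn {V V' : Type*} [AddCommGroup V] [Module (ZMod 2) V]
    [AddCommGroup V'] [Module (ZMod 2) V'] {g : V →ₗ[ZMod 2] V'} {U : Submodule (ZMod 2) V}
    (hg : Set.InjOn g U) : Module.finrank (ZMod 2) (U.map g) = Module.finrank (ZMod 2) U := by
  rw [← LinearMap.range_domRestrict]
  exact LinearMap.finrank_range_of_inj fun x y h => Subtype.ext (hg x.2 y.2 h)

theorem finrank_le_finrank_comap_add {V V' : Type*} [AddCommGroup V] [Module (ZMod 2) V]
    [FiniteDimensional (ZMod 2) V] [AddCommGroup V'] [Module (ZMod 2) V']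
    [FiniteDimensional (ZMod 2) V'] (L : V →ₗ[ZMod 2] V') {W : Submodule (ZMod 2) V'} {k : ℕ}
    (hW : Module.finrank (ZMod 2) V' ≤ Module.finrank (ZMod 2) W + k) :
    Module.finrank (ZMod 2) V ≤ Module.finrank (ZMod 2) (W.comap L) + k := by
  have h1 := (W.comap L).finrank_quotient_add_finrank
  have h2 := W.finrank_quotient_add_finrank
  have h3 : Module.finrank (ZMod 2) (V ⧸ W.comap L) ≤ Module.finrank (ZMod 2) (V' ⧸ W) := by
    refine LinearMap.finrank_le_finrank_of_injective (f := (W.comap L).mapQ W L le_rfl) ?_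
    rw [← LinearMap.ker_eq_bot, Submodule.ker_mapQ]
    simp
  omega

theorem exists_linearMap_injOn {V : Type*} [AddCommGroup V] [Module (ZMod 2) V]
    [FiniteDimensional (ZMod 2) V] (S : Submodule (ZMod 2) V) {r : ℕ}
    (hr : Module.finrank (ZMod 2) S = r) :
    ∃ g : V →ₗ[ZMod 2] (Fin r → ZMod 2), Set.InjOn g S := by
  let e : S ≃ₗ[ZMod 2] (Fin r → ZMod 2) := LinearEquiv.ofFinrankEq _ _ (by simp [hr])
  obtain ⟨g, hg⟩ := LinearMap.exists_extend e.toLinearMap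
  refine ⟨g, fun x hx y hy h => ?_⟩
  have h1 : ∀ z : S, g z = e z := fun z => by simpa using LinearMap.congr_fun hg z
  have h2 : e ⟨x, hx⟩ = e ⟨y, hy⟩ := by rw [← h1, ← h1]; exact h
  simpa using e.injective h2

theorem finrank_span_image_of_linearIndepOn {α V : Type*} [AddCommGroup V] [Module (ZMod 2) V]
    {φ : α → V} {I : Set α} (hfin : I.Finite) (hI : LinearIndepOn (ZMod 2) φ I) :
    Module.finrank (ZMod 2) (Submodule.span (ZMod 2) (φ '' I)) = I.ncard := by
  have := hfin.fintype
  rw [Set.image_eq_range, finrank_span_eq_card hI, ← Nat.card_eq_fintype_card]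
  rfl

theorem linearIndepOn_comp_image_iff {α β V : Type*} [AddCommGroup V] [Module (ZMod 2) V]
    {f : α → β} (hf : Function.Injective f) {φ : β → V} {I : Set α} :
    LinearIndepOn (ZMod 2) φ (f '' I) ↔ LinearIndepOn (ZMod 2) (φ ∘ f) I :=
  ⟨fun h => h.comp_of_image hf.injOn, fun h => h.image_of_comp⟩

section Represents

variable {α V V' : Type*} [AddCommGroup V] [Module (ZMod 2) V] [AddCommGroup V']
  [Module (ZMod 2) V'] {M : Matroid α} {φ : α → V}

theorem Represents.delete (h : Represents M φ) (D : Set α) : Represents (M ＼ D) φ := by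
  intro I hI
  rw [Matroid.delete_indep_iff,
    and_iff_left (Set.disjoint_of_subset_left hI Set.disjoint_sdiff_left)]
  exact h I (hI.trans Set.sdiff_subset)

theorem Represents.comp_injOn (h : Represents M φ) {g : V →ₗ[ZMod 2] V'}
    (hg : Set.InjOn g (Submodule.span (ZMod 2) (φ '' M.E))) : Represents M (g ∘ φ) := by
  intro I hI
  rw [h I hI, g.linearIndepOn_iff_of_injOn]
  exact hg.mono (Submodule.span_mono (Set.image_mono hI))

theorem Represents.ne_zero (hM : IsSimpleBinary M) (h : Represents M φ) {e : α} (he : e ∈ M.E) :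
    φ e ≠ 0 := by
  have h1 := hM.simple e he e he
  rw [Set.pair_eq_singleton, h _ (by simpa using he)] at h1
  simpa using h1.ne_zero (Set.mem_singleton e)

theorem Represents.injOn (hM : IsSimpleBinary M) (h : Represents M φ) : Set.InjOn φ M.E := by
  intro e he f hf hef
  have h1 := hM.simple e he f hf
  rw [h _ (Set.pair_subset he hf)] at h1
  exact h1.injOn (Set.mem_insert _ _) (Set.mem_insert_of_mem _ rfl) hef

theorem Represents.span_image_isBase (h : Represents M φ) {B : Set α} (hB : M.IsBase B) :
    Submodule.span (ZMod 2) (φ '' B) = Submodule.span (ZMod 2) (φ '' M.E) := by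
  refine le_antisymm (Submodule.span_mono (Set.image_mono hB.subset_ground)) ?_
  rw [Submodule.span_le]
  rintro _ ⟨e, he, rfl⟩
  have hBi := (h B hB.subset_ground).1 hB.indep
  rw [SetLike.mem_coe, hBi.mem_span_iff]
  intro hins
  have h1 := (h _ (Set.insert_subset he hB.subset_ground)).2 hins
  rw [hB.eq_of_subset_indep h1 (Set.subset_insert _ _)]
  exact Set.mem_insert _ _

theorem Represents.finrank_span (hfin : M.E.Finite) (h : Represents M φ) :
    Module.finrank (ZMod 2) (Submodule.span (ZMod 2) (φ '' M.E)) = rank M := by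
  obtain ⟨B, hB⟩ := M.exists_isBase
  rw [← h.span_image_isBase hB, finrank_span_image_of_linearIndepOn (hfin.subset hB.subset_ground)
    ((h B hB.subset_ground).1 hB.indep), rank, ← hB.encard_eq_eRank]
  rfl

theorem Represents.exists_isRep [FiniteDimensional (ZMod 2) V] (hfin : M.E.Finite)
    (h : Represents M φ) : ∃ g : V →ₗ[ZMod 2] (Fin (rank M) → ZMod 2),
      Set.InjOn g (Submodule.span (ZMod 2) (φ '' M.E)) ∧ IsRep M (g ∘ φ) := by
  obtain ⟨g, hg⟩ := exists_linearMap_injOn _ (h.finrank_span hfin)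
  exact ⟨g, hg, h.comp_injOn hg⟩

/-- A simple binary matroid is a restriction of the projective geometry of its own rank. -/
theorem IsSimpleBinary.exists_isRep (hM : IsSimpleBinary M) :
    ∃ φ : α → (Fin (rank M) → ZMod 2), IsRep M φ := by
  obtain ⟨n, φ, hφ⟩ := hM.binary
  have hφ' : Represents M φ := hφ
  obtain ⟨g, -, hg⟩ := hφ'.exists_isRep hM.finite
  exact ⟨_, hg⟩

theorem Represents.exists_subset_sum_eq_zero (h : Represents M φ) {ψ : α → V'}
    (h' : Represents M ψ) {t : Finset α} (ht : ↑t ⊆ M.E) (hne : t.Nonempty)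
    (h0 : ∑ e ∈ t, φ e = 0) : ∃ s ⊆ t, s.Nonempty ∧ ∑ e ∈ s, ψ e = 0 := by
  by_contra! hcon
  have h1 : LinearIndepOn (ZMod 2) ψ (t : Set α) :=
    linearIndepOn_iff_sum_ne_zero.2 fun u hu hu0 => by
      by_contra hu1
      exact hcon u (Finset.coe_subset.1 hu) (Finset.nonempty_iff_ne_empty.2 hu1) hu0
  rw [← h' _ ht, h _ ht] at h1
  exact hne.ne_empty (linearIndepOn_iff_sum_ne_zero.1 h1 t subset_rfl h0)

/-- Two binary representations of the same matroid have the same sets of zero sum: split off a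
circuit and use induction. -/
theorem Represents.sum_eq_zero (h : Represents M φ) {ψ : α → V'} (h' : Represents M ψ)
    (t : Finset α) (ht : ↑t ⊆ M.E) (h0 : ∑ e ∈ t, φ e = 0) : ∑ e ∈ t, ψ e = 0 := by
  classical
  induction t using Finset.strongInduction with
  | H t ih =>
    rcases t.eq_empty_or_nonempty with rfl | hne
    · simp
    -- A subset `s` of least size with zero sum is a circuit, so both sums over `s` vanish.
    let F := t.powerset.filter fun s => s.Nonempty ∧ ∑ e ∈ s, ψ e = 0
    have hF : F.Nonempty := by
      obtain ⟨s, hs, hs'⟩ := h.exists_subset_sum_eq_zero h' ht hne h0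
      exact ⟨s, Finset.mem_filter.2 ⟨Finset.mem_powerset.2 hs, hs'⟩⟩
    obtain ⟨s, hsF, hmin⟩ := Finset.exists_min_image F Finset.card hF
    obtain ⟨hst, hs0, hsψ⟩ := Finset.mem_filter.1 hsF
    rw [Finset.mem_powerset] at hst
    have hsE : (s : Set α) ⊆ M.E := (Finset.coe_subset.2 hst).trans ht
    obtain ⟨s', hs', hs'0, hs'φ⟩ := h'.exists_subset_sum_eq_zero h hsE hs0 hsψ
    obtain ⟨s'', hs'', hs''0, hs''ψ⟩ :=
      h.exists_subset_sum_eq_zero h' ((Finset.coe_subset.2 hs').trans hsE) hs'0 hs'φ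
    have hcard := hmin s'' (Finset.mem_filter.2
      ⟨Finset.mem_powerset.2 ((hs''.trans hs').trans hst), hs''0, hs''ψ⟩)
    have heq : s'' = s := Finset.eq_of_subset_of_card_le (hs''.trans hs') hcard
    have heq' : s' = s := hs'.antisymm (heq ▸ hs'')
    rw [heq'] at hs'φ
    have hlt : t \ s ⊂ t := Finset.sdiff_ssubset hst hs0
    have h1 := Finset.sum_sdiff (f := φ) hst
    rw [h0, hs'φ, add_zero] at h1
    rw [← Finset.sum_sdiff hst, hsψ, add_zero]
    exact ih _ hlt ((Finset.coe_subset.2 Finset.sdiff_subset).trans ht) h1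

theorem linearCombination_eq_sum_support {E : Set α} (χ : α → V) (v : E →₀ ZMod 2) :
    Finsupp.linearCombination (ZMod 2) (fun e : E => χ e) v =
      ∑ e ∈ v.support.map (Function.Embedding.subtype _), χ e := by
  rw [Finsupp.linearCombination_apply, Finsupp.sum, Finset.sum_map]
  refine Finset.sum_congr rfl fun e he => ?_
  rw [(zmod_two_eq_zero_or_one (v e)).resolve_left (Finsupp.mem_support_iff.1 he), one_smul]
  rfl

/-- Binary representations are unique: one is mapped to any other by a linear map. -/
theorem Represents.exists_linearMap (h : Represents M φ) {ψ : α → V'} (h' : Represents M ψ) :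
    ∃ L : V →ₗ[ZMod 2] V', ∀ e ∈ M.E, L (φ e) = ψ e := by
  let Φ := Finsupp.linearCombination (ZMod 2) fun e : M.E => φ e
  let Ψ := Finsupp.linearCombination (ZMod 2) fun e : M.E => ψ e
  have hker : LinearMap.ker Φ ≤ LinearMap.ker Ψ := by
    intro v hv
    rw [LinearMap.mem_ker] at hv ⊢
    have hv' := (linearCombination_eq_sum_support φ v).symm.trans hv
    refine (linearCombination_eq_sum_support ψ v).trans (h.sum_eq_zero h' _ ?_ hv')
    intro e he
    simp only [Finset.coe_map, Function.Embedding.subtype_apply, Set.mem_image] at he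
    obtain ⟨e', -, rfl⟩ := he
    exact e'.2
  obtain ⟨L, hL⟩ := LinearMap.exists_extend
    ((LinearMap.ker Φ).liftQ Ψ hker ∘ₗ Φ.quotKerEquivRange.symm.toLinearMap)
  refine ⟨L, fun e he => ?_⟩
  have h1 : Φ (Finsupp.single ⟨e, he⟩ 1) = φ e := by simp [Φ]
  have h2 : Ψ (Finsupp.single ⟨e, he⟩ 1) = ψ e := by simp [Ψ]
  have h3 := LinearMap.congr_fun hL ⟨_, LinearMap.mem_range_self Φ (Finsupp.single ⟨e, he⟩ 1)⟩
  rw [← h1, ← h2]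
  refine h3.trans ?_
  simp

/-! ### Critical numbers -/

/-- Any representation bounds the critical number: it suffices that the codimension of `U` in some
space `S` containing the represented vectors is at most `k`. -/
theorem Represents.criticalNumber_le [FiniteDimensional (ZMod 2) V] (hfin : M.E.Finite)
    (h : Represents M φ) {S U : Submodule (ZMod 2) V} {k : ℕ} (hS : ∀ e ∈ M.E, φ e ∈ S)
    (hU : ∀ e ∈ M.E, φ e ∉ U)
    (hk : Module.finrank (ZMod 2) S ≤ Module.finrank (ZMod 2) ↥(U ⊓ S) + k) :
    criticalNumber M ≤ k := by
  obtain ⟨g, hg, hgφ⟩ := h.exists_isRep hfin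
  set S' := Submodule.span (ZMod 2) (φ '' M.E) with hS'
  have hS'S : S' ≤ S := by
    rw [hS', Submodule.span_le]
    rintro _ ⟨e, he, rfl⟩
    exact hS e he
  have h1 := Submodule.finrank_sup_add_finrank_inf_eq S' (U ⊓ S)
  have h2 : Module.finrank (ZMod 2) ↥(S' ⊔ U ⊓ S) ≤ Module.finrank (ZMod 2) S :=
    Submodule.finrank_mono (sup_le hS'S inf_le_right)
  have h3 := h.finrank_span hfin
  rw [← hS'] at h3
  have h4 := finrank_map_of_injOn (U := S' ⊓ (U ⊓ S)) (hg.mono inf_le_left)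
  have h5 : Module.finrank (ZMod 2) ↥(S' ⊓ (U ⊓ S)) ≤ Module.finrank (ZMod 2) S' :=
    Submodule.finrank_mono inf_le_left
  have h6 : criticalNumber M ≤ rank M - Module.finrank (ZMod 2) ↥(S' ⊓ (U ⊓ S)) := by
    refine Nat.sInf_le ⟨rank M, g ∘ φ, rfl, hgφ, (S' ⊓ (U ⊓ S)).map g, by omega, ?_⟩
    rintro e he ⟨u, hu, hue⟩
    have := hg hu.1 (Submodule.subset_span (Set.mem_image_of_mem φ he)) hue
    exact hU e he (this ▸ hu.2.1)
  omega

/-- The infimum in the definition of the critical number is attained, because the zero subspace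
avoids all vectors of a representation. -/
theorem IsSimpleBinary.criticalNumber_spec (hM : IsSimpleBinary M) :
    ∃ (φ : α → (Fin (rank M) → ZMod 2)) (W : Submodule (ZMod 2) (Fin (rank M) → ZMod 2)),
      IsRep M φ ∧ Module.finrank (ZMod 2) W + criticalNumber M = rank M ∧
        ∀ e ∈ M.E, φ e ∉ W := by
  have hne : {c : ℕ | ∃ (r : ℕ) (φ : α → (Fin r → ZMod 2)), r = rank M ∧ IsRep M φ ∧
    ∃ W : Submodule (ZMod 2) (Fin r → ZMod 2),
      Module.finrank (ZMod 2) W + c = r ∧ ∀ e ∈ M.E, φ e ∉ W}.Nonempty := by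
    obtain ⟨φ, hφ⟩ := hM.exists_isRep
    refine ⟨rank M, rank M, φ, rfl, hφ, ⊥, by simp, fun e he => ?_⟩
    rw [Submodule.mem_bot]
    exact Represents.ne_zero hM hφ he
  obtain ⟨r, φ, rfl, hφ, W, hW, hW'⟩ := Nat.sInf_mem hne
  exact ⟨φ, W, hφ, hW, hW'⟩

theorem IsSimpleBinary.criticalNumber_le_rank (hM : IsSimpleBinary M) :
    criticalNumber M ≤ rank M := by
  obtain ⟨_, _, _, h, _⟩ := hM.criticalNumber_spec
  omega

/-- The critical number can be read off from any representation, by uniqueness of binary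
representations. -/
theorem Represents.exists_submodule_avoiding [FiniteDimensional (ZMod 2) V]
    (hM : IsSimpleBinary M) (h : Represents M φ) :
    ∃ U : Submodule (ZMod 2) V,
      Module.finrank (ZMod 2) V ≤ Module.finrank (ZMod 2) U + criticalNumber M ∧
        ∀ e ∈ M.E, φ e ∉ U := by
  obtain ⟨ψ, W, hψ, hW, hWE⟩ := hM.criticalNumber_spec
  obtain ⟨L, hL⟩ := h.exists_linearMap (show Represents M ψ from hψ)
  refine ⟨W.comap L, ?_, fun e he hmem => hWE e he ?_⟩
  · exact finrank_le_finrank_comap_add L (by rw [Module.finrank_fin_fun, hW])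
  · rw [← hL e he]
    exact hmem

end Represents

/-! ### Restrictions -/

section Restriction

variable {α β : Type u} {V V' : Type*} [AddCommGroup V] [Module (ZMod 2) V] [AddCommGroup V']
  [Module (ZMod 2) V'] {N : Matroid α} {M : Matroid β} {φ : α → V} {ψ : β → V'}

theorem HasRestriction.of_linearMap (hN : IsSimpleBinary N) (h : Represents N φ)
    (h' : Represents M ψ) {L : V →ₗ[ZMod 2] V'} (hL : Function.Injective L)
    (hNM : ∀ e ∈ N.E, ∃ b ∈ M.E, ψ b = L (φ e)) : HasRestriction N M := by
  choose f hfE hfψ using hNM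
  obtain ⟨F, hFE, hFψ⟩ : ∃ F : N.E ↪ β, (∀ e, F e ∈ M.E) ∧ ∀ e, ψ (F e) = L (φ e) := by
    refine ⟨⟨fun e => f e e.2, fun e e' hee' => ?_⟩, fun e => hfE e e.2, fun e => hfψ e e.2⟩
    have h1 : ψ (f e e.2) = ψ (f e' e'.2) := congrArg ψ hee'
    rw [hfψ _ e.2, hfψ _ e'.2] at h1
    exact Subtype.ext (h.injOn hN e.2 e'.2 (hL h1))
  have hrange : Set.range F ⊆ M.E := Set.range_subset_iff.2 hFE
  refine ⟨F, Set.range F, hrange, Matroid.ext_indep rfl fun I hI => ?_⟩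
  obtain ⟨J, rfl⟩ := Set.subset_range_iff_exists_image_eq.1 hI
  have h2 : ψ ∘ F = L ∘ φ ∘ Subtype.val := funext hFψ
  rw [Matroid.mapSetEmbedding_indep_iff, Matroid.restrict_indep_iff,
    and_iff_left (Set.image_subset_range _ _), and_iff_left (Set.image_subset_range _ _),
    Set.preimage_image_eq _ F.injective, h _ (by simp),
    h' _ ((Set.image_subset_range _ _).trans hrange),
    linearIndepOn_comp_image_iff F.injective, linearIndepOn_comp_image_iff Subtype.val_injective,
    h2, L.linearIndepOn_iff_of_injOn hL.injOn]

theorem HasRestriction.exists_represents (hNM : HasRestriction N M) (h : Represents M ψ) :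
    ∃ φ : α → V', Represents N φ ∧ ∀ e ∈ N.E, ∃ b ∈ M.E, φ e = ψ b := by
  classical
  obtain ⟨f, R, hR, hf⟩ := hNM
  have hRr : R = Set.range f := (congrArg Matroid.E hf).symm
  let φ : α → V' := fun e => if he : e ∈ N.E then ψ (f ⟨e, he⟩) else 0
  have hφ : ∀ e : N.E, φ e = ψ (f e) := fun e => by simp [φ]
  refine ⟨φ, fun I hI => ?_, fun e he => ⟨f ⟨e, he⟩, hR (hRr ▸ Set.mem_range_self _), hφ ⟨e, he⟩⟩⟩
  obtain ⟨J, rfl⟩ : ∃ J : Set N.E, Subtype.val '' J = I :=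
    Set.subset_range_iff_exists_image_eq.1 (by simpa using hI)
  have h1 : (N.mapSetEmbedding f).Indep (f '' J) ↔ N.Indep (Subtype.val '' J) := by
    rw [Matroid.mapSetEmbedding_indep_iff, and_iff_left (Set.image_subset_range _ _),
      Set.preimage_image_eq _ f.injective]
  have h2 : f '' J ⊆ R := hRr ▸ Set.image_subset_range _ _
  rw [← h1, hf, Matroid.restrict_indep_iff, and_iff_left h2, h _ (h2.trans hR),
    linearIndepOn_comp_image_iff f.injective, linearIndepOn_comp_image_iff Subtype.val_injective]
  have h3 : ψ ∘ f = φ ∘ Subtype.val := funext fun e => (hφ e).symm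
  rw [h3]

end Restriction

/-! ### Matroids of vector configurations -/

theorem exists_matroid_represents {β V : Type*} [AddCommGroup V] [Module (ZMod 2) V]
    [FiniteDimensional (ZMod 2) V] {E : Set β} (hE : E.Finite) (ψ : β → V) :
    ∃ M : Matroid β, M.E = E ∧ Represents M ψ := by
  refine ⟨(IndepMatroid.ofFinite hE
    (fun I => LinearIndepOn (ZMod 2) ψ I ∧ I ⊆ E) ?_ ?_ ?_ ?_).matroid, rfl, ?_⟩
  · exact ⟨linearIndepOn_empty _ _, Set.empty_subset _⟩
  · exact fun I J hJ hIJ => ⟨hJ.1.mono hIJ, hIJ.trans hJ.2⟩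
  · intro I J hI hJ hlt
    by_contra hcon
    have h1 : Submodule.span (ZMod 2) (ψ '' J) ≤ Submodule.span (ZMod 2) (ψ '' I) := by
      rw [Submodule.span_le]
      rintro _ ⟨e, he, rfl⟩
      rw [SetLike.mem_coe, hI.1.mem_span_iff]
      intro hins
      by_contra heI
      exact hcon ⟨e, he, heI, hins, Set.insert_subset (hJ.2 he) hI.2⟩
    have h2 := Submodule.finrank_mono h1
    rw [finrank_span_image_of_linearIndepOn (hE.subset hI.2) hI.1,
      finrank_span_image_of_linearIndepOn (hE.subset hJ.2) hJ.1] at h2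
    omega
  · exact fun I hI => hI.2
  · exact fun I hI => and_iff_left hI

theorem Represents.isSimpleBinary {β V : Type*} [AddCommGroup V] [Module (ZMod 2) V]
    [FiniteDimensional (ZMod 2) V] {M : Matroid β} {ψ : β → V} (hfin : M.E.Finite)
    (h : Represents M ψ) (h0 : ∀ e ∈ M.E, ψ e ≠ 0) (hinj : Set.InjOn ψ M.E) :
    IsSimpleBinary M := by
  refine ⟨hfin, fun e he f hf => ?_, ?_⟩
  · rw [h _ (Set.pair_subset he hf), linearIndepOn_insert_iff, linearIndepOn_singleton_iff]
    refine ⟨h0 f hf, fun hmem => ?_⟩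
    rw [Set.image_singleton, Submodule.mem_span_singleton] at hmem
    obtain ⟨t, ht⟩ := hmem
    rcases zmod_two_eq_zero_or_one t with rfl | rfl
    · exact absurd (ht.symm.trans (zero_smul _ _)) (h0 e he)
    · exact hinj he hf (ht.symm.trans (one_smul _ _))
  · obtain ⟨g, -, hg⟩ := h.exists_isRep hfin
    exact ⟨_, _, hg⟩

/-! ### The upper bound -/

theorem add_mem_thresholdSet {α : Type u} {N : Matroid α} (hN : IsSimpleBinary N)
    (hc : 1 ≤ criticalNumber N) {ε : ℝ} (hε : 0 < ε) :
    1 - 2 * (1 / 2) ^ criticalNumber N + ε ∈ thresholdSet N := by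
  classical
  set c := criticalNumber N with hcdef
  refine ⟨?_, ?_⟩
  · have h1 : ((1 : ℝ) / 2) ^ c ≤ (1 / 2) ^ 1 :=
      pow_le_pow_of_le_one (by norm_num) (by norm_num) hc
    linarith
  obtain ⟨R, hR⟩ := exists_boseBurton_of_dense.{0} c (rank N - c) hε
  refine ⟨R, fun β M hM hNM hcard => ?_⟩
  by_contra hlt
  refine hNM ?_
  have hRM : R ≤ rank M := (not_le.1 hlt).le.trans hM.criticalNumber_le_rank
  obtain ⟨φ, hφ⟩ := hM.exists_isRep
  have hφ' : Represents M φ := hφ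
  obtain ⟨W, C, hWC, hW, hC, hE⟩ := hR (Fin (rank M) → ZMod 2) (by simpa using hRM)
    (hM.finite.toFinset.image φ) (by
      rw [Finset.card_image_of_injOn (by simpa using hφ'.injOn hM),
        ← Set.ncard_eq_toFinset_card _ hM.finite]
      simpa using hcard)
  obtain ⟨ψ, U, hψ, hU, hUE⟩ := hN.criticalNumber_spec
  obtain ⟨D, hUD⟩ := U.exists_isCompl
  have hD := Submodule.finrank_add_eq_of_isCompl hUD
  rw [Module.finrank_fin_fun] at hD
  let e₁ : U ≃ₗ[ZMod 2] W := LinearEquiv.ofFinrankEq _ _ (by omega)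
  let e₂ : D ≃ₗ[ZMod 2] C := LinearEquiv.ofFinrankEq _ _ (by omega)
  let p := Submodule.prodEquivOfIsCompl U D hUD
  let L : (Fin (rank N) → ZMod 2) →ₗ[ZMod 2] (Fin (rank M) → ZMod 2) :=
    (W.subtype.coprod C.subtype) ∘ₗ ((e₁.prodCongr e₂).toLinearMap ∘ₗ p.symm.toLinearMap)
  have hL : Function.Injective L := by
    have h1 : Function.Injective (W.subtype.coprod C.subtype) := by
      rw [← LinearMap.ker_eq_bot, LinearMap.ker_coprod_of_disjoint_range _ _ (by simpa using hWC)]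
      simp
    exact h1.comp ((e₁.prodCongr e₂).injective.comp p.symm.injective)
  refine HasRestriction.of_linearMap hN hψ hφ hL fun e he => ?_
  have h1 : (p.symm (ψ e)).2 ≠ 0 := by
    intro h0
    refine hUE e he ?_
    rw [← p.apply_symm_apply (ψ e), Submodule.coe_prodEquivOfIsCompl', h0]
    simp
  have h2 := hE (e₁ (p.symm (ψ e)).1) (Subtype.property _) (e₂ (p.symm (ψ e)).2)
    (Subtype.property _) (by simpa using h1)
  simpa [L] using h2

/-! ### The lower bound -/

/-- The complement of the subspace `v.2 = 0` of codimension `b`, together with the tensor powers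
`x ⊗ ⋯ ⊗ x` of the nonzero vectors `x`, placed in that subspace. For large `d` and `s` the added
part has no small circuits but a large critical number. -/
def sparseExtension (d s b : ℕ) : Set (((Fin d → Fin s) → ZMod 2) × (Fin b → ZMod 2)) :=
  {v | v.2 = 0 → ∃ x : Fin s → ZMod 2, x ≠ 0 ∧ v.1 = tensorPow d x}

theorem tensorPow_ne_zero {d s : ℕ} {x : Fin s → ZMod 2} (hx : x ≠ 0) : tensorPow d x ≠ 0 := by
  have h := linearIndepOn_tensorPow (d := d) (x := fun _ : Unit => x) (Set.finite_singleton ())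
    (by simp) (fun _ _ => hx) (by simp)
  exact h.ne_zero (Set.mem_singleton ())

theorem ne_zero_of_mem_sparseExtension {d s b : ℕ}
    {v : ((Fin d → Fin s) → ZMod 2) × (Fin b → ZMod 2)} (hv : v ∈ sparseExtension d s b) :
    v ≠ 0 := by
  rintro rfl
  obtain ⟨x, hx, h⟩ := hv rfl
  exact tensorPow_ne_zero hx h.symm

theorem span_sparseExtension {d s b : ℕ} (hb : b ≠ 0) :
    Submodule.span (ZMod 2) (sparseExtension d s b) = ⊤ := by
  rw [eq_top_iff]
  rintro v -
  have hmem : ∀ w : ((Fin d → Fin s) → ZMod 2) × (Fin b → ZMod 2), w.2 ≠ 0 →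
      w ∈ Submodule.span (ZMod 2) (sparseExtension d s b) :=
    fun w hw => Submodule.subset_span fun h => absurd h hw
  by_cases hv : v.2 = 0
  · have : NeZero b := ⟨hb⟩
    have h1 : (1 : Fin b → ZMod 2) ≠ 0 := one_ne_zero
    have h2 := Submodule.sub_mem _ (hmem (v + (0, 1)) (by simp [hv])) (hmem (0, 1) h1)
    simpa using h2
  · exact hmem v hv

theorem ncard_sparseExtension_ge (d s b : ℕ) :
    (1 - (1 / 2 : ℝ) ^ b) *
      2 ^ Module.finrank (ZMod 2) (((Fin d → Fin s) → ZMod 2) × (Fin b → ZMod 2)) ≤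
    (sparseExtension d s b).ncard := by
  have h1 : (Set.univ : Set ((Fin d → Fin s) → ZMod 2)) ×ˢ ({0}ᶜ : Set (Fin b → ZMod 2)) ⊆
      sparseExtension d s b := fun v hv h => absurd h hv.2
  have h2 := Set.ncard_le_ncard h1 (Set.toFinite _)
  rw [Set.ncard_prod, Set.ncard_univ, Set.ncard_compl, Set.ncard_singleton,
    Nat.card_eq_fintype_card, Nat.card_eq_fintype_card] at h2
  have h3 : ((Fintype.card ((Fin d → Fin s) → ZMod 2) *
      (Fintype.card (Fin b → ZMod 2) - 1) : ℕ) : ℝ) =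
      (1 - (1 / 2 : ℝ) ^ b) *
        2 ^ Module.finrank (ZMod 2) (((Fin d → Fin s) → ZMod 2) × (Fin b → ZMod 2)) := by
    rw [Nat.cast_mul, Nat.cast_sub Fintype.card_pos, card_eq_two_pow_finrank,
      card_eq_two_pow_finrank, Module.finrank_prod, pow_add, Module.finrank_fin_fun]
    have h4 : (2 : ℝ) ^ b * (1 / 2) ^ b = 1 := by rw [← mul_pow]; norm_num
    push_cast
    linear_combination
      (2 : ℝ) ^ Module.finrank (ZMod 2) ((Fin d → Fin s) → ZMod 2) * h4
  rw [← h3]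
  exact_mod_cast h2

theorem exists_linearMap_eq_one {α V : Type*} [AddCommGroup V] [Module (ZMod 2) V]
    {φ : α → V} {I : Set α} (hI : LinearIndepOn (ZMod 2) φ I) :
    ∃ g : V →ₗ[ZMod 2] ZMod 2, ∀ e ∈ I, g (φ e) = 1 := by
  let B := Module.Basis.span hI
  obtain ⟨g, hg⟩ := LinearMap.exists_extend (B.constr (ZMod 2) fun _ => (1 : ZMod 2))
  refine ⟨g, fun e he => ?_⟩
  have h1 := LinearMap.congr_fun hg (B ⟨e, he⟩)
  rw [Module.Basis.constr_basis] at h1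
  rw [← h1]
  exact congrArg (fun z => g z.1) (Module.Basis.span_apply hI ⟨e, he⟩).symm

/-- If the elements of `N` lying in a subspace of codimension at most `b` are independent, then
deleting some independent set of rank `r(N) - b` leaves a matroid of critical number at most
`b`. -/
theorem exists_indep_criticalNumber_delete_le {α V : Type*} [AddCommGroup V] [Module (ZMod 2) V]
    [FiniteDimensional (ZMod 2) V] {N : Matroid α} (hN : IsSimpleBinary N) {φ : α → V}
    (hφ : Represents N φ) {b : ℕ} (hb : b < rank N) {W : Submodule (ZMod 2) V}
    (hW : Module.finrank (ZMod 2) V ≤ Module.finrank (ZMod 2) W + b)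
    (hI : N.Indep {e ∈ N.E | φ e ∈ W}) :
    ∃ I : Set α, N.Indep I ∧ I.ncard + b = rank N ∧ criticalNumber (N ＼ I) ≤ b := by
  set I := {e ∈ N.E | φ e ∈ W} with hIdef
  have hdel : ∀ J : Set α, (N ＼ J).E.Finite := fun J => hN.finite.subset Set.sdiff_subset
  have hIfin : I.Finite := hN.finite.subset hI.subset_ground
  rcases le_or_gt (I.ncard + b) (rank N) with hle | hgt
  · -- If `I` is small, then enlarge it; no remaining element lies in `W`.
    obtain ⟨B, hB, hIB⟩ := hI.exists_isBase_superset
    have hBcard : B.ncard = rank N := by rw [rank, ← hB.encard_eq_eRank]; rfl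
    obtain ⟨J, hIJ, hJB, hJ⟩ := Set.exists_subsuperset_card_eq (n := rank N - b) hIB
      (by omega) (by omega)
    refine ⟨J, hB.indep.subset hJB, by omega, ?_⟩
    refine (hφ.delete J).criticalNumber_le (hdel J) (S := ⊤) (U := W) (fun _ _ => trivial) ?_ ?_
    · exact fun e he heW => he.2 (hIJ ⟨he.1, heW⟩)
    · rwa [inf_top_eq, finrank_top]
  · -- If `I` is large, then the span of `I` has small codimension, and a hyperplane of it
    -- avoids the elements of `I` that are not deleted.
    obtain ⟨J, hJI, hJ⟩ := Set.exists_subset_card_eq (s := I) (n := rank N - b) (by omega)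
    refine ⟨J, hI.subset hJI, by omega, ?_⟩
    have hIφ := (hφ I hI.subset_ground).1 hI
    obtain ⟨g, hg⟩ := exists_linearMap_eq_one hIφ
    set S := Submodule.span (ZMod 2) (φ '' N.E)
    set T := Submodule.span (ZMod 2) (φ '' I)
    have hTS : T ≤ S := Submodule.span_mono (Set.image_mono hI.subset_ground)
    have hTW : T ≤ W := by
      rw [Submodule.span_le]
      rintro _ ⟨e, he, rfl⟩
      exact he.2
    refine (hφ.delete J).criticalNumber_le (hdel J) (S := S) (U := T ⊓ LinearMap.ker g)
      (fun e he => Submodule.subset_span (Set.mem_image_of_mem φ he.1)) ?_ ?_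
    · intro e he heU
      have h1 := heU.2
      rw [SetLike.mem_coe, LinearMap.mem_ker, hg e ⟨he.1, hTW heU.1⟩] at h1
      exact one_ne_zero h1
    · rw [inf_eq_left.2 (inf_le_left.trans hTS), hφ.finrank_span hN.finite]
      have hT : Module.finrank (ZMod 2) T = I.ncard :=
        finrank_span_image_of_linearIndepOn hIfin hIφ
      have h1 := Submodule.finrank_sup_add_finrank_inf_eq T (LinearMap.ker g)
      have h2 := Submodule.finrank_le (T ⊔ LinearMap.ker g)
      have h3 := g.finrank_range_add_finrank_ker
      have h4 := Submodule.finrank_le (LinearMap.range g)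
      have h5 : Module.finrank (ZMod 2) (ZMod 2) = 1 := Module.finrank_self _
      omega

/-- The matroids of `sparseExtension d s b` have density at least `1 - 2 ^ (-b)` and unbounded
critical number, for `b ≠ 0`. They have no `N`-restriction, because the tensor powers contained in
a copy of `N` are independent. -/
theorem le_of_mem_thresholdSet {α : Type u} {N : Matroid α} (hN : IsSimpleBinary N) {b : ℕ}
    (hbN : b < rank N)
    (hI : ∀ I : Set α, N.Indep I → I.ncard + b = rank N → b < criticalNumber (N ＼ I)) {a : ℝ}
    (ha : a ∈ thresholdSet N) : 1 - (1 / 2) ^ b ≤ a := by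
  obtain ⟨ha0, k, hk⟩ := ha
  rcases eq_or_ne b 0 with rfl | hb
  · simpa using ha0.le
  by_contra! hlt
  -- Any `d + 1` tensor powers are independent, which covers all elements of a copy of `N`.
  -- The choice of `s` makes the Chevalley–Warning theorem apply to `k` forms of degree `d`.
  let d := N.E.ncard + 1
  let s := k * d + 1
  let V := ((Fin d → Fin s) → ZMod 2) × (Fin b → ZMod 2)
  let ψ : ULift.{u} V → V := ULift.down
  have hψinj : Function.Injective ψ := ULift.down_injective
  obtain ⟨M, hME, hM⟩ := exists_matroid_represents
    (E := ψ ⁻¹' sparseExtension d s b) (Set.toFinite _) ψ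
  have himage : ψ '' M.E = sparseExtension d s b := by
    rw [hME, Set.image_preimage_eq _ ULift.down_surjective]
  have hMfin : M.E.Finite := Set.toFinite _
  have hMsb : IsSimpleBinary M := hM.isSimpleBinary hMfin (fun e he =>
    ne_zero_of_mem_sparseExtension (himage ▸ Set.mem_image_of_mem ψ he)) hψinj.injOn
  have hrank : rank M = Module.finrank (ZMod 2) V := by
    rw [← hM.finrank_span hMfin, himage, span_sparseExtension hb, finrank_top]
  have hcard : M.E.ncard = (sparseExtension d s b).ncard := by
    rw [← himage, Set.ncard_image_of_injective _ hψinj]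
  by_cases hNM : HasRestriction N M
  · obtain ⟨φ, hφ, hφE⟩ := hNM.exists_represents hM
    let W : Submodule (ZMod 2) V := LinearMap.ker (LinearMap.snd (ZMod 2) _ _)
    have hW : Module.finrank (ZMod 2) V ≤ Module.finrank (ZMod 2) W + b := by
      have h1 := (LinearMap.snd (ZMod 2) ((Fin d → Fin s) → ZMod 2)
        (Fin b → ZMod 2)).finrank_range_add_finrank_ker
      have h2 := Submodule.finrank_le (LinearMap.range
        (LinearMap.snd (ZMod 2) ((Fin d → Fin s) → ZMod 2) (Fin b → ZMod 2)))
      rw [Module.finrank_fin_fun] at h2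
      change _ + Module.finrank (ZMod 2) W = Module.finrank (ZMod 2) V at h1
      omega
    have hx : ∀ e ∈ {e ∈ N.E | φ e ∈ W}, ∃ x : Fin s → ZMod 2, x ≠ 0 ∧
        φ e = (tensorPow d x, 0) := by
      rintro e ⟨he, heW⟩
      obtain ⟨β, hβ, hφβ⟩ := hφE e he
      have h1 : φ e ∈ sparseExtension d s b := by
        rw [hφβ, ← himage]; exact Set.mem_image_of_mem ψ hβ
      obtain ⟨x, hx, hx'⟩ := h1 heW
      exact ⟨x, hx, Prod.ext hx' heW⟩
    choose! x hx0 hx using hx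
    have hindep : N.Indep {e ∈ N.E | φ e ∈ W} := by
      have hsub : {e ∈ N.E | φ e ∈ W} ⊆ N.E := fun e he => he.1
      rw [hφ _ hsub]
      have h1 := linearIndepOn_tensorPow (d := d) (x := x) (hN.finite.subset hsub)
        ((Set.ncard_le_ncard hsub hN.finite).trans (by omega)) hx0 (by
          intro e he f hf hef
          refine hφ.injOn hN he.1 hf.1 ?_
          rw [hx e he, hx f hf, hef])
      refine LinearIndepOn.of_comp (LinearMap.fst (ZMod 2) _ _) ?_
      refine (linearIndepOn_congr fun e he => ?_).1 h1
      simp only [Function.comp_apply, hx e he]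
      rfl
    obtain ⟨I, hIN, hIr, hle⟩ :=
      exists_indep_criticalNumber_delete_le hN hφ hbN hW hindep
    exact (hI I hIN hIr).not_ge hle
  · have hle := hk _ M hMsb hNM (by
      rw [hcard, hrank]
      exact (mul_le_mul_of_nonneg_right hlt.le (by positivity)).trans
        (ncard_sparseExtension_ge d s b))
    obtain ⟨U, hU, hUE⟩ := hM.exists_submodule_avoiding hMsb
    obtain ⟨x, hx, hxU⟩ := exists_tensorPow_mem (d := d) (s := s) (k := k) (by omega) (by omega)
      (U.comap (LinearMap.inl (ZMod 2) _ (Fin b → ZMod 2)))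
      (finrank_le_finrank_comap_add _ (hU.trans (Nat.add_le_add_left hle _)))
    refine hUE ⟨(tensorPow d x, 0)⟩ ?_ hxU
    rw [hME]
    exact fun _ => ⟨x, hx, rfl⟩

end CritMatroid

/-- The rank condition `r(I) = r(N) - c + 1` is written `r(I) + c = r(N) + 1`, and `N ＼ I` is
Mathlib's deletion of `I` from `N`. -/
theorem theorem1p6 {α : Type u} (N : Matroid α) (hN : CritMatroid.IsSimpleBinary N)
    (c : ℕ) (hc : 1 ≤ c) (hNc : CritMatroid.criticalNumber N = c)
    (hI : ∀ I : Set α, N.Indep I → N.eRk I + c = N.eRank + 1 →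
      CritMatroid.criticalNumber (N ＼ I) = c) :
    CritMatroid.criticalThreshold N = 1 - (2 : ℝ) ^ (1 - (c : ℤ)) := by
  obtain ⟨b, rfl⟩ : ∃ b, c = b + 1 := ⟨c - 1, by omega⟩
  have hpow : (2 : ℝ) ^ (1 - ((b + 1 : ℕ) : ℤ)) = (1 / 2) ^ b := by
    push_cast
    rw [sub_add_cancel_right, zpow_neg, zpow_natCast, one_div, inv_pow]
  have hpow' : 2 * (1 / 2 : ℝ) ^ (b + 1) = (1 / 2) ^ b := by
    rw [pow_succ]; ring
  rw [hpow]
  have hmem : ∀ ε : ℝ, 0 < ε → 1 - (1 / 2) ^ b + ε ∈ CritMatroid.thresholdSet N := by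
    intro ε hε
    have := CritMatroid.add_mem_thresholdSet hN (hNc ▸ hc) hε
    rwa [hNc, hpow'] at this
  have hbN : b < CritMatroid.rank N := by
    have := hN.criticalNumber_le_rank
    omega
  have hlower : ∀ a ∈ CritMatroid.thresholdSet N, 1 - (1 / 2 : ℝ) ^ b ≤ a := by
    intro a ha
    refine CritMatroid.le_of_mem_thresholdSet hN hbN (fun I hIN hIr => ?_) ha
    have hfin : N.E.Finite := hN.finite
    have hIfin := hfin.subset hIN.subset_ground
    have hr : (CritMatroid.rank N : ℕ∞) = N.eRank :=
      ENat.natCast_toNat (ne_top_of_le_ne_top hfin.encard_lt_top.ne N.eRank_le_encard_ground)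
    rw [hI I hIN (by
      rw [hIN.eRk_eq_encard, ← hr, ← hIr, ← hIfin.cast_ncard_eq]
      push_cast
      rw [add_assoc])]
    exact Nat.lt_succ_self b
  refine le_antisymm (le_of_forall_pos_le_add fun ε hε => ?_)
    (le_csInf ⟨_, hmem 1 one_pos⟩ hlower)
  exact csInf_le ⟨_, hlower⟩ (hmem ε hε)
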